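/- Let $\Theta$ and $U$ be compact metric spaces, $\Theta$ non-empty, and let $H$ be a complex Hilbert space. Let $\theta\mapsto\rho(\theta)$ be an injective map from $\Theta$ to the density operators on $H$ (positive trace-class operators of trace one) which is regular: for every compact $K\subseteq\Theta$, as $\delta\downarrow0$, $$\inf\{\|X\|_1 : X \text{ trace class},\ -X\le\rho(\theta)-\rho(\eta)\le X \text{ for all }\theta,\eta\in K\text{ with } d(\theta,\eta)<\delta\}\to0.$$ Let $w:\Theta\times U\to\mathbb R$ be a continuous loss function. A POVM on $U$ is a map $M$ from the Borel sets of $U$ to the positive operators on $H$ that is countably additive in the weak operator topology and satisfies $M(U)=I$; its risk function is $R_M(\theta)=\int_U w(\theta,u)\,\mathrm{Tr}\,\rho(\theta)M(du)$. A Borel probability measure $\pi$ on $\Theta$ is a least favorable prior if $$\inf_M\int_\Theta R_M\,d\pi=\sup_{\pi'}\inf_M\int_\Theta R_M\,d\pi',$$ where $M$ ranges over all POVMs on $U$ and $\pi'$ over all Borel probability measures on $\Theta$. A POVM is minimax if it minimizes $\sup_{\theta\in\Theta}R_M(\theta)$ among all POVMs, and Bayes with respect to $\pi$ if it minimizes $\int_\Theta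 R_M\,d\pi$ among all POVMs. Then there exists a least favorable prior, and for every least favorable prior $\pi_{LF}$, every minimax POVM is a Bayes POVM with respect to $\pi_{LF}$. -/

import Mathlib

open MeasureTheory Filter Topology
open scoped ENNReal InnerProductSpace

noncomputable section

/-! ### Trace-class operators on a complex Hilbert space -/

section TraceClass

lemma summable_coeff_sq {H : Type*} [NormedAddCommGroup H] [InnerProductSpace ℂ H]
    {ι : Type*} (b : HilbertBasis ι ℂ H) {x : ι → H}
    (hx : Summable fun j => ‖x j‖ ^ 2) :
    Summable fun p : ι × ι => ‖⟪x p.1, b p.2⟫_ℂ‖ ^ 2 := by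
  have hrow : ∀ j, HasSum (fun i => ‖⟪x j, b i⟫_ℂ‖ ^ 2) (‖x j‖ ^ 2) := by
    intro j
    have h := b.hasSum_inner_mul_inner (x j) (x j)
    have h' := Complex.hasSum_re h
    have e : (⟪x j, x j⟫_ℂ).re = ‖x j‖ ^ 2 := by
      rw [inner_self_eq_norm_sq_to_K]; norm_cast
    rw [e] at h'
    refine h'.congr_fun fun i => ?_
    rw [← inner_conj_symm (b i) (x j), Complex.mul_conj, Complex.normSq_eq_norm_sq]
    norm_cast
  rw [summable_prod_of_nonneg (fun p => by positivity)]
  exact ⟨fun j => (hrow j).summable, by simpa only [(hrow _).tsum_eq] using hx⟩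

variable (H : Type*) [NormedAddCommGroup H] [InnerProductSpace ℂ H] [CompleteSpace H]

/-- The index set of a fixed orthonormal basis of `H`. -/
def stdHilbertIndex : Set H := (exists_hilbertBasis ℂ H).choose

/-- A fixed orthonormal (Hilbert) basis of `H`, of any cardinality. -/
def stdHilbert : HilbertBasis (stdHilbertIndex H) ℂ H :=
  (exists_hilbertBasis ℂ H).choose_spec.choose

variable {H}

/-- The trace norm `‖T‖₁ = Tr |T|`, where `|T| = (T* T)^{1/2}`. -/
def traceNorm (T : H →L[ℂ] H) : ℝ≥0∞ :=
  ∑' i, ENNReal.ofReal (⟪stdHilbert H i, CFC.abs T (stdHilbert H i)⟫_ℂ).re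

/-- `T` is a trace-class operator. -/
def IsTraceClass (T : H →L[ℂ] H) : Prop := traceNorm T < ∞

/-- The trace `Tr T = ∑ ⟨eᵢ, T eᵢ⟩` of a trace-class operator; the series then converges
absolutely and its value does not depend on the orthonormal basis. -/
def opTrace (T : H →L[ℂ] H) : ℂ :=
  ∑' i, ⟪stdHilbert H i, T (stdHilbert H i)⟫_ℂ

lemma inner_sqrt_sqrt {T : H →L[ℂ] H} (hT : 0 ≤ T) (x y : H) :
    ⟪CFC.sqrt T x, CFC.sqrt T y⟫_ℂ = ⟪x, T y⟫_ℂ := by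
  have hs : (CFC.sqrt T).IsPositive :=
    (ContinuousLinearMap.nonneg_iff_isPositive _).1 (CFC.sqrt_nonneg T)
  have h1 : ⟪CFC.sqrt T x, CFC.sqrt T y⟫_ℂ = ⟪x, CFC.sqrt T (CFC.sqrt T y)⟫_ℂ :=
    hs.isSymmetric x (CFC.sqrt T y)
  rw [h1, ← mul_apply_eq_comp, CFC.sqrt_mul_sqrt_self T hT]

lemma summable_norm_sqrt {T : H →L[ℂ] H} (hT : 0 ≤ T) (hT' : IsTraceClass T) :
    Summable fun i => ‖CFC.sqrt T (stdHilbert H i)‖ ^ 2 := by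
  have h : ∀ i, (⟪stdHilbert H i, CFC.abs T (stdHilbert H i)⟫_ℂ).re
      = ‖CFC.sqrt T (stdHilbert H i)‖ ^ 2 := by
    intro i
    rw [CFC.abs_of_nonneg T hT, ← inner_sqrt_sqrt hT, inner_self_eq_norm_sq_to_K]
    norm_cast
  have h2 : (∑' i, ENNReal.ofReal (‖CFC.sqrt T (stdHilbert H i)‖ ^ 2)) ≠ ∞ := by
    have := hT'.ne
    unfold traceNorm at this
    simpa only [h] using this
  have h3 := ENNReal.summable_toReal h2
  refine h3.congr fun i => ?_
  rw [ENNReal.toReal_ofReal (by positivity)]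

lemma hasSum_trace_mul {T A : H →L[ℂ] H} (hT : 0 ≤ T) (hT' : IsTraceClass T) (hA : 0 ≤ A) :
    HasSum (fun i => ⟪CFC.sqrt T (stdHilbert H i), A (CFC.sqrt T (stdHilbert H i))⟫_ℂ)
      (opTrace (T * A)) := by
  set b := stdHilbert H with hb
  set S := CFC.sqrt T with hS
  have hSs : ∀ x y : H, ⟪S x, y⟫_ℂ = ⟪x, S y⟫_ℂ :=
    ((ContinuousLinearMap.nonneg_iff_isPositive _).1 (CFC.sqrt_nonneg T)).isSymmetric
  have hAs : ∀ x y : H, ⟪A x, y⟫_ℂ = ⟪x, A y⟫_ℂ :=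
    ((ContinuousLinearMap.nonneg_iff_isPositive _).1 hA).isSymmetric
  have hs1 : Summable fun i => ‖S (b i)‖ ^ 2 := summable_norm_sqrt hT hT'
  have hs2 : Summable fun i => ‖A (S (b i))‖ ^ 2 := by
    refine Summable.of_nonneg_of_le (fun i => by positivity) (fun i => ?_)
      (hs1.mul_left (‖A‖ ^ 2))
    rw [← mul_pow]
    exact pow_le_pow_left₀ (norm_nonneg _) (A.le_opNorm _) 2
  have hc1 := summable_coeff_sq b hs1
  have hc2 := summable_coeff_sq b hs2
  have hsum : Summable fun p : stdHilbertIndex H × stdHilbertIndex H =>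
      ⟪A (S (b p.1)), b p.2⟫_ℂ * ⟪b p.2, S (b p.1)⟫_ℂ := by
    refine Summable.of_norm_bounded (hc1.add hc2) fun p => ?_
    rw [norm_mul, norm_inner_symm (b p.2)]
    nlinarith [sq_nonneg (‖⟪A (S (b p.1)), b p.2⟫_ℂ‖ - ‖⟪S (b p.1), b p.2⟫_ℂ‖),
      sq_nonneg ‖⟪A (S (b p.1)), b p.2⟫_ℂ‖, sq_nonneg ‖⟪S (b p.1), b p.2⟫_ℂ‖]
  have hrow : ∀ j, HasSum (fun i => ⟪A (S (b j)), b i⟫_ℂ * ⟪b i, S (b j)⟫_ℂ)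
      ⟪S (b j), A (S (b j))⟫_ℂ := fun j => by
    rw [← hAs]; exact b.hasSum_inner_mul_inner _ _
  have hcol : ∀ i, HasSum (fun j => ⟪A (S (b j)), b i⟫_ℂ * ⟪b i, S (b j)⟫_ℂ)
      ⟪b i, (T * A) (b i)⟫_ℂ := fun i => by
    have h := b.hasSum_inner_mul_inner (S (b i)) (S (A (b i)))
    rw [hS, inner_sqrt_sqrt hT, ← hS] at h
    refine h.congr_fun fun j => ?_
    rw [hAs, hSs, hSs (b i), mul_comm]
  have h1 := hsum.hasSum.prod_fiberwise hrow
  have h2 := ((Equiv.prodComm _ _).hasSum_iff.2 hsum.hasSum).prod_fiberwise hcol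
  have h3 : opTrace (T * A) = _ := h2.tsum_eq
  rw [h3]
  exact h1

lemma ofReal_trace_mul {T A : H →L[ℂ] H} (hT : 0 ≤ T) (hT' : IsTraceClass T) (hA : 0 ≤ A) :
    ENNReal.ofReal (opTrace (T * A)).re = ∑' i, ENNReal.ofReal
      (⟪CFC.sqrt T (stdHilbert H i), A (CFC.sqrt T (stdHilbert H i))⟫_ℂ).re := by
  have h := Complex.hasSum_re (hasSum_trace_mul hT hT' hA)
  rw [← h.tsum_eq, ENNReal.ofReal_tsum_of_nonneg _ h.summable]
  intro i
  exact ((ContinuousLinearMap.nonneg_iff_isPositive _).1 hA).re_inner_nonneg_right _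

end TraceClass

/-! ### Measurements -/

/-- A positive-operator-valued measure on the Borel sets of `U`: a function on the Borel sets,
countably additive in the weak operator topology (this is Mathlib's `VectorMeasure`, which takes
the value `0` at sets that are not measurable), with positive values and total value `1`. -/
structure POVM (U H : Type*) [MeasurableSpace U]
    [NormedAddCommGroup H] [InnerProductSpace ℂ H] [CompleteSpace H] where
  toVectorMeasure : VectorMeasure U (H →WOT[ℂ] H)
  nonneg' : ∀ B, MeasurableSet B → 0 ≤ (toVectorMeasure B).toCLM
  univ' : (toVectorMeasure Set.univ).toCLM = 1

section Problem

variable {Θ U H : Type*} [NormedAddCommGroup H] [InnerProductSpace ℂ H] [CompleteSpace H]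

/-- The operator `M(B)`. -/
def POVM.op [MeasurableSpace U] (M : POVM U H) (B : Set U) : H →L[ℂ] H :=
  (M.toVectorMeasure B).toCLM

lemma POVM.hasSum_inner [MeasurableSpace U] (M : POVM U H) {B : ℕ → Set U}
    (hB : ∀ n, MeasurableSet (B n)) (hd : Pairwise (Function.onFun Disjoint B)) (x : H) :
    HasSum (fun n => ⟪x, M.op (B n) x⟫_ℂ) ⟪x, M.op (⋃ n, B n) x⟫_ℂ := by
  have h := M.toVectorMeasure.m_iUnion hB hd
  unfold HasSum at h ⊢
  have h' := ContinuousLinearMapWOT.tendsto_iff_forall_inner_apply_tendsto.1 h x x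
  refine h'.congr fun s => ?_
  have : (∑ n ∈ s, M.toVectorMeasure (B n)).toCLM = ∑ n ∈ s, M.op (B n) :=
    map_sum (ContinuousLinearMapWOT.addEquiv (σ := RingHom.id ℂ) (E := H) (F := H)) _ s
  rw [← ContinuousLinearMapWOT.coe_toCLM, this, sum_apply, inner_sum]

variable (H) in
/-- A density operator: positive, trace class, of trace one. -/
structure DensityOperator where
  op : H →L[ℂ] H
  nonneg : 0 ≤ op
  traceClass : IsTraceClass op
  trace_eq_one : opTrace op = 1

/-- The distribution `B ↦ Tr (ρ M(B))` of the outcome (the Born rule). -/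
def bornMeasure [MeasurableSpace U] (ρ : DensityOperator H) (M : POVM U H) : Measure U :=
  Measure.ofMeasurable (fun B _ => ENNReal.ofReal (opTrace (ρ.op * M.op B)).re)
    (by
      have h : M.op ∅ = 0 := by
        unfold POVM.op; rw [M.toVectorMeasure.empty]; rfl
      simp [h, opTrace])
    (by
      intro B hB hd
      have hpos : ∀ A, MeasurableSet A → 0 ≤ M.op A := M.nonneg'
      simp only [ofReal_trace_mul ρ.nonneg ρ.traceClass (hpos _ (MeasurableSet.iUnion hB)),
        ofReal_trace_mul ρ.nonneg ρ.traceClass (hpos _ (hB _))]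
      rw [ENNReal.tsum_comm]
      refine tsum_congr fun i => ?_
      have h := Complex.hasSum_re
        (M.hasSum_inner hB hd (CFC.sqrt ρ.op (stdHilbert H i)))
      rw [← h.tsum_eq, ENNReal.ofReal_tsum_of_nonneg _ h.summable]
      intro n
      exact ((ContinuousLinearMap.nonneg_iff_isPositive _).1
        (hpos _ (hB n))).re_inner_nonneg_right _)

/-- `ω_T(K_δ) = inf {‖X‖₁ : X trace class, -X ≤ T θ - T η ≤ X for all θ, η ∈ K, d(θ, η) < δ}`,
with value `∞` if there is no such `X`. -/
def omega [MetricSpace Θ] (T : Θ → H →L[ℂ] H) (K : Set Θ) (δ : ℝ) : ℝ≥0∞ :=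
  sInf {r | ∃ X : H →L[ℂ] H, IsTraceClass X ∧ r = traceNorm X ∧
    ∀ θ ∈ K, ∀ η ∈ K, dist θ η < δ → -X ≤ T θ - T η ∧ T θ - T η ≤ X}

/-- A regular operator-valued function. -/
def IsRegularFamily [MetricSpace Θ] (T : Θ → H →L[ℂ] H) : Prop :=
  ∀ K : Set Θ, IsCompact K → Tendsto (fun δ => omega T K δ) (𝓝[>] 0) (𝓝 0)

variable [MeasurableSpace U]

/-- The risk function `R_M(θ) = ∫ w(θ, u) Tr (ρ(θ) M(du))`. -/
def risk (ρ : Θ → DensityOperator H) (w : Θ × U → ℝ) (M : POVM U H) (θ : Θ) : ℝ :=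
  ∫ u, w (θ, u) ∂(bornMeasure (ρ θ) M)

/-- The average risk `∫ R_M(θ) π(dθ)`. -/
def avgRisk [MeasurableSpace Θ] (ρ : Θ → DensityOperator H) (w : Θ × U → ℝ) (M : POVM U H)
    (π : ProbabilityMeasure Θ) : ℝ :=
  ∫ θ, risk ρ w M θ ∂(π : Measure Θ)

/-- The worst-case risk `sup_θ R_M(θ)`, in the extended reals. -/
def supRisk (ρ : Θ → DensityOperator H) (w : Θ × U → ℝ) (M : POVM U H) : EReal :=
  ⨆ θ, (risk ρ w M θ : EReal)

/-- The Bayes risk `inf_M ∫ R_M dπ`, in the extended reals. -/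
def bayesRisk [MeasurableSpace Θ] (ρ : Θ → DensityOperator H) (w : Θ × U → ℝ) (π : ProbabilityMeasure Θ) : EReal :=
  ⨅ M : POVM U H, (avgRisk ρ w M π : EReal)

/-- `π` is a least favorable prior: it maximizes `inf_M ∫ R_M dπ`. -/
def IsLeastFavorable [MeasurableSpace Θ] (ρ : Θ → DensityOperator H) (w : Θ × U → ℝ)
    (π : ProbabilityMeasure Θ) : Prop :=
  bayesRisk ρ w π = ⨆ π' : ProbabilityMeasure Θ, bayesRisk ρ w π'

/-- `M` is a Bayes POVM with respect to `π`: it minimizes the average risk. -/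
def IsBayes [MeasurableSpace Θ] (ρ : Θ → DensityOperator H) (w : Θ × U → ℝ) (π : ProbabilityMeasure Θ)
    (M : POVM U H) : Prop :=
  ∀ M' : POVM U H, avgRisk ρ w M π ≤ avgRisk ρ w M' π

/-- `M` is a minimax POVM: it minimizes the worst-case risk. -/
def IsMinimax (ρ : Θ → DensityOperator H) (w : Θ × U → ℝ) (M : POVM U H) : Prop :=
  ∀ M' : POVM U H, supRisk ρ w M ≤ supRisk ρ w M'

end Problem

end

/-! ### Quadratic forms of ordered operators. -/

section PositiveOperator

variable {H : Type*} [NormedAddCommGroup H] [InnerProductSpace ℂ H]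

/-! Regularity makes every risk function continuous (`continuous_risk`): a dominating `X` adds to
the outcome law at most a measure of mass `‖X‖₁`, whatever the POVM. Average risk is thus weakly
continuous in the prior, and the Bayes risk, an infimum of such functions, is upper semicontinuous
on a compact space: it attains its maximum.

Let a minimax POVM `M` have worst-case risk `v`. Every risk function reaches `v` somewhere, and risk
functions form a convex set, so separating this set from `{f < v}` (`exists_prior_of_convex`) gives
a prior with Bayes risk at least `v`. A least favorable prior also has Bayes risk at least `v`,
while the average risk of `M` under it is at most `v`. No compactness of the set of POVMs is needed.
-/

lemma re_inner_mono {S T : H →L[ℂ] H} (h : S ≤ T) (x : H) :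
    (⟪x, S x⟫_ℂ).re ≤ (⟪x, T x⟫_ℂ).re := by
  have := ((ContinuousLinearMap.le_def _ _).1 h).re_inner_nonneg_right x
  simpa [inner_sub_right] using this

lemma re_inner_nonneg {T : H →L[ℂ] H} (h : 0 ≤ T) (x : H) : 0 ≤ (⟪x, T x⟫_ℂ).re :=
  ((ContinuousLinearMap.nonneg_iff_isPositive _).1 h).re_inner_nonneg_right x

end PositiveOperator

/-! ### Outcome measures of positive operators; randomization. -/

section PositiveTraceClass

variable {H : Type*} [NormedAddCommGroup H] [InnerProductSpace ℂ H] [CompleteSpace H]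

lemma inner_sqrt_left {T : H →L[ℂ] H} (x y : H) :
    ⟪CFC.sqrt T x, y⟫_ℂ = ⟪x, CFC.sqrt T y⟫_ℂ :=
  ((ContinuousLinearMap.nonneg_iff_isPositive _).1 (CFC.sqrt_nonneg T)).isSymmetric x y

lemma ofReal_re_inner_apply_eq_tsum {A : H →L[ℂ] H} (hA : 0 ≤ A) (x : H) :
    ENNReal.ofReal (⟪x, A x⟫_ℂ).re
      = ∑' j, ENNReal.ofReal (‖⟪stdHilbert H j, CFC.sqrt A x⟫_ℂ‖ ^ 2) := by
  have h := (stdHilbert H).hasSum_inner_mul_inner (CFC.sqrt A x) (CFC.sqrt A x)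
  rw [inner_sqrt_sqrt hA] at h
  have h' : HasSum (fun j => ‖⟪stdHilbert H j, CFC.sqrt A x⟫_ℂ‖ ^ 2) (⟪x, A x⟫_ℂ).re := by
    refine (Complex.hasSum_re h).congr_fun fun j => ?_
    rw [← inner_conj_symm (CFC.sqrt A x), mul_comm, Complex.mul_conj, Complex.normSq_eq_norm_sq]
    norm_cast
  rw [← h'.tsum_eq, ENNReal.ofReal_tsum_of_nonneg (fun _ => by positivity) h'.summable]

/-- Cyclicity of the trace of a product of two positive operators. -/
lemma tsum_inner_sqrt_comm {T A : H →L[ℂ] H} (hT : 0 ≤ T) (hA : 0 ≤ A) :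
    ∑' i, ENNReal.ofReal
        (⟪CFC.sqrt T (stdHilbert H i), A (CFC.sqrt T (stdHilbert H i))⟫_ℂ).re
      = ∑' i, ENNReal.ofReal
        (⟪CFC.sqrt A (stdHilbert H i), T (CFC.sqrt A (stdHilbert H i))⟫_ℂ).re := by
  simp only [ofReal_re_inner_apply_eq_tsum hA, ofReal_re_inner_apply_eq_tsum hT]
  rw [ENNReal.tsum_comm]
  refine tsum_congr fun j => tsum_congr fun i => ?_
  -- `√A √T` and `√T √A` are adjoint, so their matrix coefficients have equal moduli.
  rw [← inner_sqrt_left, ← inner_sqrt_left, norm_inner_symm]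

lemma traceNorm_of_nonneg {T : H →L[ℂ] H} (hT : 0 ≤ T) :
    traceNorm T = ∑' i, ENNReal.ofReal (⟪stdHilbert H i, T (stdHilbert H i)⟫_ℂ).re := by
  rw [traceNorm, CFC.abs_of_nonneg T hT]

variable {U : Type*} [MeasurableSpace U]

namespace POVM

lemma op_nonneg (M : POVM U H) {B : Set U} (hB : MeasurableSet B) : 0 ≤ M.op B := M.nonneg' B hB

lemma op_univ (M : POVM U H) : M.op Set.univ = 1 := M.univ'

lemma op_empty (M : POVM U H) : M.op ∅ = 0 := by
  unfold POVM.op; rw [M.toVectorMeasure.empty]; rfl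

/-- The measure `B ↦ ⟨x, M(B) x⟩`. -/
noncomputable def vectorStateMeasure (M : POVM U H) (x : H) : Measure U :=
  Measure.ofMeasurable (fun B _ => ENNReal.ofReal (⟪x, M.op B x⟫_ℂ).re)
    (by simp [M.op_empty])
    (by
      intro B hB hd
      have h := Complex.hasSum_re (M.hasSum_inner hB hd x)
      rw [← h.tsum_eq, ENNReal.ofReal_tsum_of_nonneg _ h.summable]
      exact fun n => re_inner_nonneg (M.op_nonneg (hB n)) x)

lemma vectorStateMeasure_apply (M : POVM U H) (x : H) {B : Set U} (hB : MeasurableSet B) :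
    M.vectorStateMeasure x B = ENNReal.ofReal (⟪x, M.op B x⟫_ℂ).re :=
  Measure.ofMeasurable_apply B hB

/-- The measure `B ↦ Tr (T M(B))`, for a positive operator `T`. -/
noncomputable def traceMeasure (M : POVM U H) (T : H →L[ℂ] H) : Measure U :=
  Measure.sum fun i => M.vectorStateMeasure (CFC.sqrt T (stdHilbert H i))

lemma traceMeasure_apply (M : POVM U H) (T : H →L[ℂ] H) {B : Set U} (hB : MeasurableSet B) :
    M.traceMeasure T B = ∑' i, ENNReal.ofReal
      (⟪CFC.sqrt T (stdHilbert H i), M.op B (CFC.sqrt T (stdHilbert H i))⟫_ℂ).re := by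
  rw [traceMeasure, Measure.sum_apply _ hB]
  exact tsum_congr fun i => M.vectorStateMeasure_apply _ hB

/-- Cyclicity replaces `√T` by `T` itself, so that monotonicity and additivity in `T` can be read
off term by term. -/
lemma traceMeasure_apply' (M : POVM U H) {T : H →L[ℂ] H} (hT : 0 ≤ T) {B : Set U}
    (hB : MeasurableSet B) :
    M.traceMeasure T B = ∑' i, ENNReal.ofReal
      (⟪CFC.sqrt (M.op B) (stdHilbert H i), T (CFC.sqrt (M.op B) (stdHilbert H i))⟫_ℂ).re := by
  rw [traceMeasure_apply M T hB, tsum_inner_sqrt_comm hT (M.op_nonneg hB)]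

lemma traceMeasure_univ (M : POVM U H) {T : H →L[ℂ] H} (hT : 0 ≤ T) :
    M.traceMeasure T Set.univ = traceNorm T := by
  rw [traceMeasure_apply M T MeasurableSet.univ, traceNorm_of_nonneg hT]
  simp only [M.op_univ, one_apply_eq_self, inner_sqrt_sqrt hT]

lemma traceMeasure_le_add (M : POVM U H) {R S T : H →L[ℂ] H} (hR : 0 ≤ R) (hS : 0 ≤ S)
    (hT : 0 ≤ T) (h : R ≤ S + T) :
    M.traceMeasure R ≤ M.traceMeasure S + M.traceMeasure T := by
  refine Measure.le_iff.2 fun B hB => ?_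
  rw [Measure.add_apply, M.traceMeasure_apply' hR hB, M.traceMeasure_apply' hS hB,
    M.traceMeasure_apply' hT hB, ← ENNReal.tsum_add]
  refine ENNReal.tsum_le_tsum fun i => ?_
  rw [← ENNReal.ofReal_add (re_inner_nonneg hS _) (re_inner_nonneg hT _)]
  refine ENNReal.ofReal_le_ofReal ((re_inner_mono h _).trans_eq ?_)
  simp

end POVM

lemma bornMeasure_eq_traceMeasure (ρ : DensityOperator H) (M : POVM U H) :
    bornMeasure ρ M = M.traceMeasure ρ.op := by
  ext B hB
  rw [bornMeasure, Measure.ofMeasurable_apply B hB, M.traceMeasure_apply _ hB,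
    ofReal_trace_mul ρ.nonneg ρ.traceClass (M.op_nonneg hB)]

instance isProbabilityMeasure_bornMeasure (ρ : DensityOperator H) (M : POVM U H) :
    IsProbabilityMeasure (bornMeasure ρ M) := by
  constructor
  rw [bornMeasure, Measure.ofMeasurable_apply _ MeasurableSet.univ, M.op_univ, mul_one,
    ρ.trace_eq_one]
  simp

namespace POVM

/-- The randomization of two measurements. -/
noncomputable def mix (M N : POVM U H) {s t : ℝ} (hs : 0 ≤ s) (ht : 0 ≤ t) (hst : s + t = 1) :
    POVM U H where
  toVectorMeasure := s • M.toVectorMeasure + t • N.toVectorMeasure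
  nonneg' B hB := add_nonneg (smul_nonneg hs (M.op_nonneg hB)) (smul_nonneg ht (N.op_nonneg hB))
  univ' := by
    change s • M.op Set.univ + t • N.op Set.univ = 1
    rw [M.op_univ, N.op_univ, ← add_smul, hst, one_smul]

lemma op_mix (M N : POVM U H) {s t : ℝ} (hs : 0 ≤ s) (ht : 0 ≤ t) (hst : s + t = 1) (B : Set U) :
    (M.mix N hs ht hst).op B = s • M.op B + t • N.op B := rfl

end POVM

lemma bornMeasure_mix (ρ : DensityOperator H) (M N : POVM U H) {s t : ℝ} (hs : 0 ≤ s)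
    (ht : 0 ≤ t) (hst : s + t = 1) :
    bornMeasure ρ (M.mix N hs ht hst)
      = ENNReal.ofReal s • bornMeasure ρ M + ENNReal.ofReal t • bornMeasure ρ N := by
  ext B hB
  simp only [bornMeasure_eq_traceMeasure, Measure.add_apply, Measure.smul_apply, smul_eq_mul,
    POVM.traceMeasure_apply _ _ hB]
  rw [← ENNReal.tsum_mul_left, ← ENNReal.tsum_mul_left, ← ENNReal.tsum_add]
  refine tsum_congr fun i => ?_
  rw [← ENNReal.ofReal_mul hs, ← ENNReal.ofReal_mul ht,
    ← ENNReal.ofReal_add (mul_nonneg hs (re_inner_nonneg (M.op_nonneg hB) _))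
      (mul_nonneg ht (re_inner_nonneg (N.op_nonneg hB) _)), POVM.op_mix]
  simp [inner_smul_right_eq_smul]

end PositiveTraceClass

/-! ### Continuity and affinity of the risk. -/

section Risk

/-- The shift `f + C` takes values in `[0, 2C]`, so its integral is monotone in the measure; the
shift cancels because `μ` and `ν` have equal mass. -/
lemma integral_le_of_le_add {U : Type*} [MeasurableSpace U] {μ ν τ : Measure U}
    [IsProbabilityMeasure μ] [IsProbabilityMeasure ν] [IsFiniteMeasure τ] (h : μ ≤ ν + τ)
    {f : U → ℝ} (hf : AEStronglyMeasurable f (ν + τ)) {C : ℝ} (hC : ∀ u, |f u| ≤ C) :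
    ∫ u, f u ∂μ ≤ ∫ u, f u ∂ν + 2 * C * τ.real Set.univ := by
  have hint : Integrable f (ν + τ) := .of_bound hf C (.of_forall hC)
  have hintν := hint.mono_measure (Measure.le_add_right (le_refl ν))
  have hintτ := hint.mono_measure (Measure.le_add_left (le_refl τ))
  have hintμ := hint.mono_measure h
  have hle : ∫ u, (f u + C) ∂μ ≤ ∫ u, (f u + C) ∂(ν + τ) := by
    refine integral_mono_measure h (.of_forall fun u => ?_) (hint.add (integrable_const C))
    have := abs_le.1 (hC u)
    simp only [Pi.zero_apply]
    linarith
  have hτ : ∫ u, (f u + C) ∂τ ≤ 2 * C * τ.real Set.univ := by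
    have : ∫ u, (f u + C) ∂τ ≤ ∫ _, 2 * C ∂τ := by
      refine integral_mono (hintτ.add (integrable_const C)) (integrable_const _) fun u => ?_
      have := abs_le.1 (hC u)
      simp only
      linarith
    rwa [integral_const, smul_eq_mul, mul_comm] at this
  have hsplit : ∫ u, (f u + C) ∂(ν + τ) = ∫ u, (f u + C) ∂ν + ∫ u, (f u + C) ∂τ :=
    integral_add_measure (hintν.add (integrable_const C)) (hintτ.add (integrable_const C))
  rw [hsplit, integral_add hintμ (integrable_const C), integral_add hintν (integrable_const C)] at hle
  simp only [integral_const, probReal_univ, one_smul] at hle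
  linarith

lemma abs_integral_sub_le_of_le_add {U : Type*} [MeasurableSpace U] {μ ν τ : Measure U}
    [IsProbabilityMeasure μ] [IsProbabilityMeasure ν] [IsFiniteMeasure τ] (h : μ ≤ ν + τ)
    {f : U → ℝ} (hf : AEStronglyMeasurable f (ν + τ)) {C : ℝ} (hC : ∀ u, |f u| ≤ C) :
    |∫ u, f u ∂μ - ∫ u, f u ∂ν| ≤ 2 * C * τ.real Set.univ := by
  have h1 := integral_le_of_le_add h hf hC
  have h2 := integral_le_of_le_add (f := fun u => -f u) h hf.neg (C := C) (by simpa using hC)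
  rw [integral_neg, integral_neg] at h2
  exact abs_le.2 ⟨by linarith, by linarith⟩

variable {Θ U H : Type*} [NormedAddCommGroup H] [InnerProductSpace ℂ H] [CompleteSpace H]
  [MetricSpace Θ] [CompactSpace Θ] [MetricSpace U] [CompactSpace U] [MeasurableSpace U]
  [BorelSpace U]

/-- A regular family is continuous in the order-trace-norm sense. -/
lemma IsRegularFamily.exists_dominating {T : Θ → H →L[ℂ] H} (hT : IsRegularFamily T) {ε : ℝ≥0∞}
    (hε : 0 < ε) :
    ∃ δ > 0, ∃ X : H →L[ℂ] H, traceNorm X < ε ∧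
      ∀ θ η, dist θ η < δ → -X ≤ T θ - T η ∧ T θ - T η ≤ X := by
  have h := ((hT Set.univ isCompact_univ).eventually (gt_mem_nhds hε)).and self_mem_nhdsWithin
  obtain ⟨δ, hδ, hδ0⟩ := h.exists
  obtain ⟨_, ⟨X, -, rfl, hX⟩, hlt⟩ := sInf_lt_iff.1 hδ
  exact ⟨δ, hδ0, X, hlt, fun θ η => hX θ trivial η trivial⟩

/-- Half of `ε` pays for changing the loss at a fixed state (sup norm of the curried loss), half for
changing the state at a fixed loss. -/
lemma continuous_risk {ρ : Θ → DensityOperator H} (hρ : IsRegularFamily fun θ => (ρ θ).op)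
    {w : Θ × U → ℝ} (hw : Continuous w) (M : POVM U H) : Continuous (risk ρ w M) := by
  obtain ⟨C, hC⟩ : ∃ C, ∀ p, |w p| ≤ C := by
    obtain ⟨C, hC⟩ := isCompact_univ.exists_bound_of_continuousOn hw.continuousOn
    exact ⟨C, fun p => hC p trivial⟩
  have hsec : ∀ θ, Continuous fun u => w (θ, u) := fun θ => by fun_prop
  let F : C(Θ, C(U, ℝ)) := ContinuousMap.curry ⟨w, hw⟩
  refine Metric.continuous_iff.2 fun η ε hε => ?_
  obtain ⟨δ₁, hδ₁, h₁⟩ := Metric.continuous_iff.1 F.continuous η (ε / 2) (half_pos hε)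
  have hc : 0 < ε / (4 * (|C| + 1)) := by positivity
  obtain ⟨δ₂, hδ₂, X, hXlt, hX⟩ := hρ.exists_dominating (ENNReal.ofReal_pos.2 hc)
  refine ⟨min δ₁ δ₂, lt_min hδ₁ hδ₂, fun θ hθ => ?_⟩
  -- Domination on the diagonal, where the difference vanishes.
  have hX0 : 0 ≤ X := by simpa using (hX η η (by simpa using hδ₂)).2
  have hle : bornMeasure (ρ θ) M ≤ bornMeasure (ρ η) M + M.traceMeasure X := by
    simp only [bornMeasure_eq_traceMeasure]
    refine M.traceMeasure_le_add (ρ θ).nonneg (ρ η).nonneg hX0 ?_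
    exact sub_le_iff_le_add'.1 (hX θ η (hθ.trans_le (min_le_right _ _))).2
  have : IsFiniteMeasure (M.traceMeasure X) :=
    ⟨by rw [M.traceMeasure_univ hX0]; exact hXlt.trans ENNReal.ofReal_lt_top⟩
  have hreal : (M.traceMeasure X).real Set.univ < ε / (4 * (|C| + 1)) := by
    rw [measureReal_def, M.traceMeasure_univ hX0]
    exact (ENNReal.lt_ofReal_iff_toReal_lt (hXlt.trans ENNReal.ofReal_lt_top).ne).1 hXlt
  have hstate := abs_integral_sub_le_of_le_add hle (hsec η).aestronglyMeasurable
    fun u => hC (η, u)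
  have hint : ∀ θ', Integrable (fun u => w (θ', u)) (bornMeasure (ρ θ) M) := fun θ' =>
    .of_bound (hsec θ').aestronglyMeasurable C (.of_forall fun u => hC (θ', u))
  have hloss : |∫ u, w (θ, u) ∂(bornMeasure (ρ θ) M) - ∫ u, w (η, u) ∂(bornMeasure (ρ θ) M)|
      ≤ dist (F θ) (F η) := by
    rw [← integral_sub (hint θ) (hint η), ← Real.norm_eq_abs]
    refine (norm_integral_le_of_norm_le_const (C := dist (F θ) (F η))
      (.of_forall fun u => ?_)).trans_eq (by simp)
    exact ContinuousMap.dist_apply_le_dist (f := F θ) (g := F η) u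
  have hsmall : 2 * C * (M.traceMeasure X).real Set.univ ≤ ε / 2 := by
    calc 2 * C * (M.traceMeasure X).real Set.univ
        ≤ 2 * (|C| + 1) * (ε / (4 * (|C| + 1))) := by
          gcongr
          linarith [le_abs_self C]
      _ = ε / 2 := by field_simp; norm_num
  have hF := h₁ θ (hθ.trans_le (min_le_left _ _))
  rw [Real.dist_eq, risk, risk]
  have := abs_sub_le (∫ u, w (θ, u) ∂(bornMeasure (ρ θ) M))
    (∫ u, w (η, u) ∂(bornMeasure (ρ θ) M)) (∫ u, w (η, u) ∂(bornMeasure (ρ η) M))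
  linarith

lemma risk_mix (ρ : Θ → DensityOperator H) {w : Θ × U → ℝ} (hw : Continuous w) (M N : POVM U H)
    {s t : ℝ} (hs : 0 ≤ s) (ht : 0 ≤ t) (hst : s + t = 1) (θ : Θ) :
    risk ρ w (M.mix N hs ht hst) θ = s * risk ρ w M θ + t * risk ρ w N θ := by
  obtain ⟨C, hC⟩ := isCompact_univ.exists_bound_of_continuousOn hw.continuousOn
  have hsec : Continuous fun u => w (θ, u) := by fun_prop
  have hint : ∀ N' : POVM U H, Integrable (fun u => w (θ, u)) (bornMeasure (ρ θ) N') := fun N' =>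
    .of_bound hsec.aestronglyMeasurable C (.of_forall fun u => hC (θ, u) trivial)
  rw [risk, bornMeasure_mix, integral_add_measure ((hint M).smul_measure ENNReal.ofReal_ne_top)
    ((hint N).smul_measure ENNReal.ofReal_ne_top), integral_smul_measure, integral_smul_measure,
    ENNReal.toReal_ofReal hs, ENNReal.toReal_ofReal ht, risk, risk, smul_eq_mul, smul_eq_mul]

end Risk

/-! ### Separation, priors and the conclusion. -/

section Minimax

variable {Θ : Type*} [MetricSpace Θ] [CompactSpace Θ] [MeasurableSpace Θ] [BorelSpace Θ]

/-- A positive functional on `C(Θ, ℝ)` that is positive at `1` is a multiple of the expectation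
for a probability measure. -/
lemma exists_probabilityMeasure_of_positive (Λ : C(Θ, ℝ) →ₗ[ℝ] ℝ)
    (hΛ : ∀ f : C(Θ, ℝ), 0 ≤ f → 0 ≤ Λ f) (h1 : 0 < Λ 1) :
    ∃ π : ProbabilityMeasure Θ, ∀ f : C(Θ, ℝ), Λ f = Λ 1 * ∫ θ, f θ ∂(π : Measure Θ) := by
  let toC : CompactlySupportedContinuousMap Θ ℝ →ₗ[ℝ] C(Θ, ℝ) :=
    { toFun := fun f => f.toContinuousMap
      map_add' := fun _ _ => rfl
      map_smul' := fun _ _ => rfl }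
  let Λ' : CompactlySupportedContinuousMap Θ ℝ →ₚ[ℝ] ℝ :=
    PositiveLinearMap.mk₀ (Λ ∘ₗ toC) fun f hf => hΛ _ fun θ => hf θ
  set μ := RealRMK.rieszMeasure Λ' with hμ
  have hint : ∀ f : C(Θ, ℝ), ∫ θ, f θ ∂μ = Λ f := fun f =>
    RealRMK.integral_rieszMeasure Λ' (CompactlySupportedContinuousMap.continuousMapEquiv f)
  have hmass : μ.real Set.univ = Λ 1 := by simpa using hint 1
  have hμ0 : μ Set.univ ≠ 0 := fun h0 => by simp [measureReal_def, h0] at hmass; linarith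
  have hμ0' : NeZero μ := ⟨fun h0 => hμ0 (by simp [h0])⟩
  refine ⟨⟨(μ Set.univ)⁻¹ • μ, inferInstance⟩, fun f => ?_⟩
  change _ = _ * ∫ θ, f θ ∂((μ Set.univ)⁻¹ • μ)
  rw [integral_smul_measure, hint, ENNReal.toReal_inv, ← measureReal_def, hmass, smul_eq_mul,
    mul_inv_cancel_left₀ h1.ne']

/-- The minimax inequality for a convex set of continuous functions on a compact space. -/
lemma exists_prior_of_convex {K : Set C(Θ, ℝ)} (hK : Convex ℝ K) (hne : K.Nonempty) {s : ℝ}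
    (hs : ∀ f ∈ K, ∃ θ, s ≤ f θ) :
    ∃ π : ProbabilityMeasure Θ, ∀ f ∈ K, s ≤ ∫ θ, f θ ∂(π : Measure Θ) := by
  let V : Set C(Θ, ℝ) := {f | ∀ θ, f θ < s}
  have hVc : Convex ℝ V := by
    intro f hf g hg a b ha hb hab θ
    simpa using (convex_Iio s) (hf θ) (hg θ) ha hb hab
  have hVo : IsOpen V := by
    have := ContinuousMap.isOpen_setOfPred_mapsTo (X := Θ) (Y := ℝ) isCompact_univ
      (isOpen_Iio (a := s))
    simpa [V, Set.MapsTo] using this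
  have hdisj : Disjoint V K := Set.disjoint_left.2 fun f hfV hfK => by
    obtain ⟨θ, hθ⟩ := hs f hfK
    exact (hfV θ).not_ge hθ
  obtain ⟨Λ, u, hΛV, hΛK⟩ := geometric_hahn_banach_open hVc hVo hK hdisj
  have hpos : ∀ f : C(Θ, ℝ), 0 ≤ f → 0 ≤ Λ f := by
    intro f hf
    by_contra! hneg
    -- `V` is stable under subtracting multiples of `f ≥ 0`; were `Λ f < 0`, these would push `Λ`
    -- past `u`.
    obtain ⟨n, hn⟩ := exists_nat_gt ((u - Λ ((s - 1) • (1 : C(Θ, ℝ)))) / (-Λ f))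
    rw [div_lt_iff₀ (by linarith)] at hn
    have := hΛV ((s - 1) • (1 : C(Θ, ℝ)) - (n : ℝ) • f) fun θ => by
      have : 0 ≤ (n : ℝ) * f θ := mul_nonneg n.cast_nonneg (hf θ)
      simp
      linarith
    rw [map_sub, map_smul Λ (n : ℝ), smul_eq_mul] at this
    linarith
  have hbelow : ∀ ε > 0, (s - ε) * Λ 1 < u := by
    intro ε hε
    have := hΛV ((s - ε) • (1 : C(Θ, ℝ))) fun θ => by simpa using hε
    rwa [map_smul, smul_eq_mul] at this
  have h1 : 0 < Λ 1 := by
    -- If `Λ 1 = 0`, constants in `V` force `u > 0`, while `f ≤ ‖f‖` gives `Λ f ≤ 0` on `K`,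
    -- contradicting `u ≤ Λ f`.
    refine (hpos 1 zero_le_one).lt_of_ne fun h0 => ?_
    have hu : 0 < u := by simpa [← h0] using hbelow 1 one_pos
    obtain ⟨f, hf⟩ := hne
    have hle : Λ f ≤ ‖f‖ * Λ 1 := by
      have := hpos (‖f‖ • (1 : C(Θ, ℝ)) - f) fun θ => by
        simpa using (le_abs_self _).trans (f.norm_coe_le_norm θ)
      rw [map_sub, map_smul, smul_eq_mul] at this
      linarith
    rw [← h0, mul_zero] at hle
    linarith [hΛK f hf]
  have hsu : s * Λ 1 ≤ u := by
    refine le_of_forall_pos_lt_add fun ε hε => ?_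
    have := hbelow (ε / Λ 1) (by positivity)
    rw [sub_mul, div_mul_cancel₀ _ h1.ne'] at this
    linarith
  obtain ⟨π, hπ⟩ := exists_probabilityMeasure_of_positive Λ.toLinearMap hpos h1
  refine ⟨π, fun f hf => le_of_mul_le_mul_left ?_ h1⟩
  have : Λ f = Λ 1 * ∫ θ, f θ ∂(π : Measure Θ) := hπ f
  rw [← this, mul_comm]
  exact hsu.trans (hΛK f hf)

variable [Nonempty Θ]

lemma exists_isLeastFavorable {U H : Type*} [MetricSpace U] [CompactSpace U] [MeasurableSpace U]
    [BorelSpace U] [NormedAddCommGroup H] [InnerProductSpace ℂ H] [CompleteSpace H]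
    {ρ : Θ → DensityOperator H} (hρ : IsRegularFamily fun θ => (ρ θ).op) {w : Θ × U → ℝ}
    (hw : Continuous w) : ∃ π : ProbabilityMeasure Θ, IsLeastFavorable ρ w π := by
  have hcont : ∀ M : POVM U H, Continuous fun π : ProbabilityMeasure Θ => avgRisk ρ w M π :=
    fun M => ProbabilityMeasure.continuous_integral_boundedContinuousFunction
      (BoundedContinuousFunction.mkOfCompact ⟨risk ρ w M, continuous_risk hρ hw M⟩)
  have husc : UpperSemicontinuous (bayesRisk ρ w) :=
    upperSemicontinuous_iInf fun M =>
      (continuous_coe_real_ereal.comp (hcont M)).upperSemicontinuous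
  have : Nonempty (ProbabilityMeasure Θ) :=
    ⟨⟨Measure.dirac (Classical.arbitrary Θ), inferInstance⟩⟩
  obtain ⟨π, -, hπ⟩ := (husc.upperSemicontinuousOn Set.univ).exists_isMaxOn Set.univ_nonempty
    isCompact_univ
  exact ⟨π, le_antisymm (le_iSup (bayesRisk ρ w) π) (iSup_le fun π' => hπ (Set.mem_univ π'))⟩

lemma IsLeastFavorable.isBayes_of_isMinimax {U H : Type*} [MetricSpace U] [CompactSpace U]
    [MeasurableSpace U] [BorelSpace U] [NormedAddCommGroup H] [InnerProductSpace ℂ H]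
    [CompleteSpace H] {ρ : Θ → DensityOperator H} (hρ : IsRegularFamily fun θ => (ρ θ).op)
    {w : Θ × U → ℝ} (hw : Continuous w) {π : ProbabilityMeasure Θ}
    (hπ : IsLeastFavorable ρ w π) {M : POVM U H} (hM : IsMinimax ρ w M) : IsBayes ρ w π M := by
  let R : POVM U H → C(Θ, ℝ) := fun N => ⟨risk ρ w N, continuous_risk hρ hw N⟩
  -- Attainment makes the worst-case risk a real number and gives the pointwise bound that
  -- separation from the strict set requires.
  have hmax : ∀ N, ∃ θ, supRisk ρ w N = risk ρ w N θ ∧ ∀ η, risk ρ w N η ≤ risk ρ w N θ := by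
    intro N
    obtain ⟨θ, -, hθ⟩ := isCompact_univ.exists_isMaxOn Set.univ_nonempty (R N).continuous.continuousOn
    have hle : ∀ η, risk ρ w N η ≤ risk ρ w N θ := fun η => hθ (Set.mem_univ η)
    exact ⟨θ, le_antisymm (iSup_le fun η => EReal.coe_le_coe_iff.2 (hle η))
      (le_iSup (fun η => (risk ρ w N η : EReal)) θ), hle⟩
  obtain ⟨θ₀, hθ₀, hle⟩ := hmax M
  have hK : Convex ℝ (Set.range R) := by
    rintro _ ⟨N₁, rfl⟩ _ ⟨N₂, rfl⟩ a b ha hb hab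
    exact ⟨N₁.mix N₂ ha hb hab, ContinuousMap.ext fun θ => risk_mix ρ hw N₁ N₂ ha hb hab θ⟩
  obtain ⟨π₀, hπ₀⟩ := exists_prior_of_convex hK ⟨_, M, rfl⟩ (s := risk ρ w M θ₀) (by
    rintro _ ⟨N, rfl⟩
    obtain ⟨θ, hθ, -⟩ := hmax N
    exact ⟨θ, EReal.coe_le_coe_iff.1 (by rw [← hθ₀]; exact (hM N).trans_eq hθ)⟩)
  have hbayes : (risk ρ w M θ₀ : EReal) ≤ bayesRisk ρ w π := by
    rw [hπ]
    exact (le_iInf fun N => EReal.coe_le_coe_iff.2 (hπ₀ _ ⟨N, rfl⟩)).trans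
      (le_iSup (bayesRisk ρ w) π₀)
  have havg : avgRisk ρ w M π ≤ risk ρ w M θ₀ := by
    have hint : Integrable (risk ρ w M) (π : Measure Θ) :=
      (R M).continuous.integrable_of_hasCompactSupport (.of_compactSpace _)
    refine (integral_mono hint (integrable_const (risk ρ w M θ₀)) hle).trans_eq (by simp)
  exact fun N => havg.trans (EReal.coe_le_coe_iff.1 (hbayes.trans (iInf_le _ N)))

end Minimax

theorem theorem4 {Θ U H : Type*}
    [MetricSpace Θ] [CompactSpace Θ] [Nonempty Θ] [MeasurableSpace Θ] [BorelSpace Θ]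
    [MetricSpace U] [CompactSpace U] [MeasurableSpace U] [BorelSpace U]
    [NormedAddCommGroup H] [InnerProductSpace ℂ H] [CompleteSpace H]
    (ρ : Θ → DensityOperator H) (hρ_inj : Function.Injective ρ)
    (hρ_reg : IsRegularFamily fun θ => (ρ θ).op)
    (w : Θ × U → ℝ) (hw : Continuous w) :
    (∃ π : ProbabilityMeasure Θ, IsLeastFavorable ρ w π) ∧
      ∀ π : ProbabilityMeasure Θ, IsLeastFavorable ρ w π →
        ∀ M : POVM U H, IsMinimax ρ w M → IsBayes ρ w π M :=
  ⟨exists_isLeastFavorable hρ_reg hw, fun _ hπ _ hM => hπ.isBayes_of_isMinimax hρ_reg hw hM⟩
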